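/- Let $x_1,\dots,x_n$ be boolean variables. A literal is a variable or its negation, a clause is an unordered triple of literals on three different variables, and $T(n)$ is the set of all $8\binom n3$ clauses. A 3-SAT instance with $m$ clauses is a tuple $C=(c_1,\dots,c_m)\in T(n)^m$ (repetitions allowed); it is satisfiable, written $\mathrm{SAT}(C)$, if some truth assignment makes at least one literal of every $c_i$ true. A probability distribution $D$ on $T(n)^m$ is $k$-clause independent if for all distinct indices $i_1,\dots,i_k$ and all $t_1,\dots,t_k\in T(n)$, $$\Pr_{C\sim D}[c_{i_1}=t_1,\dots,c_{i_k}=t_k]=|T(n)|^{-k};$$ $\mathcal F_k(n,m)$ is the set of all such $D$. For $n\ge 3$ let $\mathrm{UST}_k(n)$ be the minimum $m$ such that $\Pr_{C\sim D}[\mathrm{SAT}(C)]\le 1/3$ for every $D\in\mathcal F_k(n,m)$. Theorem. (1) $\mathrm{UST}_4(n)=O(n^2)$: there is an absolute constant $K$ such that for every $n\ge 3$ the minimum defining $\mathrm{UST}_4(n)$ exists and $\mathrm{UST}_4(n)\le K n^2$. (2) There is an absolute constant $K$ such that for all positive integers $n,m$ and every $D\in\mathcal F_4(n,m)$, $$\Pr_{C\sim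 D}[\mathrm{SAT}(C)]\le K\max\left\{\frac{n^2}{m},\frac1{\sqrt n}\right\}.$$ (3) For all positive integers $n,m$ with $m\le\sqrt{10}\,n^{5/2}$ and every $D\in\mathcal F_4(n,m)$, $$\Pr_{C\sim D}[\mathrm{SAT}(C)]\le \frac{4288\,n^2}{m}.$$ -/

import Mathlib

/-- A literal over `n` boolean variables: a variable together with a sign
(`true` for the variable itself, `false` for its negation). -/
abbrev Literal (n : ℕ) : Type := Fin n × Bool

/-- A 3-clause: an unordered triple of literals on three different variables. -/
def Clause (n : ℕ) : Type :=
  {c : Finset (Literal n) // c.card = 3 ∧ ∀ l ∈ c, ∀ l' ∈ c, l.1 = l'.1 → l = l'}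

instance (n : ℕ) : DecidableEq (Clause n) :=
  inferInstanceAs (DecidableEq
    {c : Finset (Literal n) // c.card = 3 ∧ ∀ l ∈ c, ∀ l' ∈ c, l.1 = l'.1 → l = l'})

instance (n : ℕ) : Fintype (Clause n) :=
  inferInstanceAs (Fintype
    {c : Finset (Literal n) // c.card = 3 ∧ ∀ l ∈ c, ∀ l' ∈ c, l.1 = l'.1 → l = l'})

/-- A 3-SAT instance with `n` variables and `m` clauses, repetitions allowed.
The clauses are listed as `c 0, …, c (m - 1)`. -/
abbrev Instance3SAT (n m : ℕ) : Type := Fin m → Clause n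

/-- The assignment `σ` makes the literal `l` true. -/
def LiteralTrue {n : ℕ} (σ : Fin n → Bool) (l : Literal n) : Prop := σ l.1 = l.2

/-- The instance `C` has a satisfying assignment: each of its clauses has at least one literal
that is true under the assignment. -/
def Satisfiable {n m : ℕ} (C : Instance3SAT n m) : Prop :=
  ∃ σ : Fin n → Bool, ∀ i : Fin m, ∃ l ∈ (C i).1, LiteralTrue σ l

/-- The probability of the event `A` when the instance is drawn from `D`. -/
noncomputable def prob {n m : ℕ} (D : PMF (Instance3SAT n m)) (A : Set (Instance3SAT n m)) : ℝ :=
  (D.toOuterMeasure A).toReal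

/-- The family of `k`-clause independent distributions with `m` clauses over `n` variables: any `k`
fixed (distinct positions of) clauses are distributed uniformly over all `k`-tuples of clauses. -/
def clauseIndependent (k n m : ℕ) : Set (PMF (Instance3SAT n m)) :=
  {D | ∀ (i : Fin k ↪ Fin m) (t : Fin k → Clause n),
    prob D {C | ∀ j, C (i j) = t j} = ∏ _j : Fin k, (1 / (Fintype.card (Clause n) : ℝ))}

/-- The numbers `m` of clauses such that an instance drawn from any `k`-clause independent
distribution with `m` clauses over `n` variables is satisfiable with probability at most `1/3`. -/
def unsatSizes (k n : ℕ) : Set ℕ :=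
  {m | ∀ D ∈ clauseIndependent k n m, prob D {C | Satisfiable C} ≤ 1 / 3}

/-- The upper satisfiability threshold: the minimum of `unsatSizes k n`. -/
noncomputable def UST (k n : ℕ) : ℕ := sInf (unsatSizes k n)

/-! A low-degree statistic refutes satisfiability. Fix an assignment. To each clause attach the
vector `colSum`, indexed by ordered pairs of literals, which puts at each pair of distinct literals
of the clause the ±1 value of the third one. The weight `pairWeight` has inner product exactly 6
with this vector as soon as the clause is satisfied (`sum_pairWeight_mul_colSum`), so a satisfying
assignment gives a total of 6m.

By Cauchy–Schwarz, 36m² is at most 196n² times the squared norm of the sum of the m vectors. That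
norm is a diagonal 6m plus a quadratic form in the ±1 variable values with matrix 2·`crossGram`.
Bounding the form entrywise by AM-GM eliminates the assignment and leaves `energy`, a function of
the instance alone (`sq_le_energy_of_satisfiable`).

The squared entries of `crossGram` involve at most four clauses at a time, so 4-clause independence
determines their expectation. Negating one variable in one clause kills all cross terms
(`expect_gram_mul_gram`), and the remaining second moment is O(m²/n²). Markov's inequality then
gives `prob_satisfiable_le`, from which all three claims follow. -/

/-! ### Expectation and Markov's inequality -/

/-- The expectation of `f` when the instance is drawn from `D`. -/
noncomputable def expect {n m : ℕ} (D : PMF (Instance3SAT n m)) (f : Instance3SAT n m → ℝ) : ℝ :=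
  ∑ C, (D C).toReal * f C

namespace expect

variable {n m : ℕ} (D : PMF (Instance3SAT n m))

lemma finset_sum {ι : Type*} (s : Finset ι) (f : ι → Instance3SAT n m → ℝ) :
    expect D (fun C => ∑ i ∈ s, f i C) = ∑ i ∈ s, expect D (f i) := by
  simp only [expect, Finset.mul_sum]
  exact Finset.sum_comm

lemma const_mul (r : ℝ) (f : Instance3SAT n m → ℝ) :
    expect D (fun C => r * f C) = r * expect D f := by
  simp only [expect, Finset.mul_sum]
  exact Finset.sum_congr rfl fun C _ => by ring

lemma add (f g : Instance3SAT n m → ℝ) :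
    expect D (fun C => f C + g C) = expect D f + expect D g := by
  simp only [expect, mul_add, Finset.sum_add_distrib]

lemma sum_toReal : ∑ C, (D C).toReal = 1 := by
  have h := D.tsum_coe
  rw [tsum_fintype] at h
  rw [← ENNReal.toReal_sum fun C _ => D.apply_ne_top C, h, ENNReal.toReal_one]

lemma const (r : ℝ) : expect D (fun _ => r) = r := by
  simp only [expect, ← Finset.sum_mul, sum_toReal, one_mul]

end expect

lemma prob_eq_sum {n m : ℕ} (D : PMF (Instance3SAT n m)) (A : Set (Instance3SAT n m))
    [DecidablePred (· ∈ A)] :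
    prob D A = ∑ C with C ∈ A, (D C).toReal := by
  rw [prob, PMF.toOuterMeasure_apply_fintype, ENNReal.toReal_sum, Finset.sum_filter]
  · refine Finset.sum_congr rfl fun C _ => ?_
    by_cases h : C ∈ A <;> simp [h]
  · intro C _
    by_cases h : C ∈ A <;> simp [h, D.apply_ne_top C]

lemma prob_le_one {n m : ℕ} (D : PMF (Instance3SAT n m)) (A : Set (Instance3SAT n m)) :
    prob D A ≤ 1 := by
  classical
  rw [prob_eq_sum, ← expect.sum_toReal D]
  exact Finset.sum_le_univ_sum_of_nonneg fun _ => ENNReal.toReal_nonneg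

/-- Markov's inequality. -/
lemma mul_prob_le_expect {n m : ℕ} (D : PMF (Instance3SAT n m)) (A : Set (Instance3SAT n m))
    (f : Instance3SAT n m → ℝ) (r : ℝ) (hf : ∀ C, 0 ≤ f C) (h : ∀ C ∈ A, r ≤ f C) :
    r * prob D A ≤ expect D f := by
  classical
  rw [prob_eq_sum, Finset.mul_sum, Finset.sum_filter, expect]
  refine Finset.sum_le_sum fun C _ => ?_
  split_ifs with hC
  · rw [mul_comm]
    exact mul_le_mul_of_nonneg_left (h C hC) ENNReal.toReal_nonneg
  · exact mul_nonneg ENNReal.toReal_nonneg (hf C)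

/-! ### Consequences of clause independence -/

section Independence

variable {n m k : ℕ} {D : PMF (Instance3SAT n m)}

lemma expect_comp_embedding (hD : D ∈ clauseIndependent k n m) (e : Fin k ↪ Fin m)
    (g : (Fin k → Clause n) → ℝ) :
    expect D (fun C => g (C ∘ e)) = (1 / (Fintype.card (Clause n) : ℝ)) ^ k * ∑ t, g t := by
  classical
  rw [expect, ← Finset.sum_fiberwise Finset.univ (fun C : Instance3SAT n m => C ∘ e),
    Finset.mul_sum]
  refine Finset.sum_congr rfl fun t _ => ?_
  have h := hD e t
  rw [prob_eq_sum, Finset.prod_const, Finset.card_univ, Fintype.card_fin] at h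
  rw [← h, Finset.sum_mul]
  refine Finset.sum_congr ?_ fun C hC => ?_
  · ext C
    simp [funext_iff]
  · have : C ∘ e = t := funext (by simpa using hC)
    rw [this]

lemma exists_embedding_range (hm : k ≤ m) (S : Finset (Fin m)) (hS : S.card ≤ k) :
    ∃ e : Fin k ↪ Fin m, ∀ i ∈ S, ∃ r, e r = i := by
  obtain ⟨S', hSS', -, hcard⟩ := Finset.exists_subsuperset_card_eq (Finset.subset_univ S) hS
    (by simpa using hm)
  refine ⟨(S'.orderEmbOfFin hcard).toEmbedding, fun i hi => ?_⟩
  have : i ∈ Set.range (S'.orderEmbOfFin hcard) := by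
    rw [Finset.range_orderEmbOfFin]; exact hSS' hi
  exact this

/-- A function of at most `k` clauses that changes sign under an involution of one clause has
expectation zero. -/
lemma expect_eq_zero_of_odd (hD : D ∈ clauseIndependent k n m) (hm : k ≤ m)
    (S : Finset (Fin m)) (hS : S.card ≤ k) (f : Instance3SAT n m → ℝ)
    (hf : ∀ C C', (∀ i ∈ S, C i = C' i) → f C = f C') (i : Fin m) (hi : i ∈ S)
    (φ : Clause n → Clause n) (hφ : ∀ c, φ (φ c) = c)
    (hodd : ∀ C, f (Function.update C i (φ (C i))) = - f C) : expect D f = 0 := by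
  classical
  obtain ⟨e, he⟩ := exists_embedding_range hm S hS
  -- `C₀` only fills the positions outside the range of `e`, which `f` does not see.
  obtain ⟨C₀, -⟩ := D.support_nonempty
  have h1 : f = fun C => (fun t => f (Function.extend e t C₀)) (C ∘ e) := by
    funext C
    refine hf _ _ fun j hj => ?_
    obtain ⟨r, rfl⟩ := he j hj
    rw [e.injective.extend_apply]; rfl
  rw [h1, expect_comp_embedding hD e fun t => f (Function.extend e t C₀)]
  obtain ⟨r, rfl⟩ := he i hi
  have hψ : Function.Involutive (fun t : Fin k → Clause n => Function.update t r (φ (t r))) := by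
    intro t
    simp [hφ]
  have h2 : ∑ t, f (Function.extend e t C₀) = - ∑ t, f (Function.extend e t C₀) := by
    conv_lhs => rw [← Equiv.sum_comp (hψ.toPerm _)]
    rw [← Finset.sum_neg_distrib]
    refine Finset.sum_congr rfl fun t _ => ?_
    rw [← hodd]
    refine hf _ _ fun j hj => ?_
    obtain ⟨s, rfl⟩ := he j hj
    rw [e.injective.extend_apply]
    by_cases hs : s = r
    · subst hs
      simp [e.injective.extend_apply]
    · have : e s ≠ e r := fun h => hs (e.injective h)
      simp [hs, this, e.injective.extend_apply]
  have : ∑ t, f (Function.extend e t C₀) = 0 := by linarith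
  rw [this, mul_zero]

lemma expect_pair (hD : D ∈ clauseIndependent 4 n m) (hm : 4 ≤ m) {i j : Fin m} (hij : i ≠ j)
    (f : Clause n → Clause n → ℝ) :
    expect D (fun C => f (C i) (C j)) =
      (1 / (Fintype.card (Clause n) : ℝ)) ^ 2 * ∑ c, ∑ c', f c c' := by
  classical
  -- Pad the two positions to four; summing out the two extra clauses gives the factor |T(n)|²,
  -- which cancels.
  obtain ⟨S, hS, -, hcard⟩ := Finset.exists_subsuperset_card_eq
    (Finset.subset_univ ({i, j} : Finset (Fin m))) (n := 4)
    (by rw [Finset.card_pair hij]; norm_num) (by simpa using hm)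
  have h2 : (S \ {i, j}).card = 2 := by
    rw [Finset.card_sdiff_of_subset hS, hcard, Finset.card_pair hij]
  obtain ⟨a, b, hab, hS2⟩ := Finset.card_eq_two.mp h2
  have ha : a ∈ S \ {i, j} := by simp [hS2]
  have hb : b ∈ S \ {i, j} := by simp [hS2]
  simp only [Finset.mem_sdiff, Finset.mem_insert, Finset.mem_singleton, not_or] at ha hb
  let e : Fin 4 ↪ Fin m := ⟨![i, j, a, b], by
    intro x y h
    fin_cases x <;> fin_cases y <;> simp_all [eq_comm]⟩
  have key := expect_comp_embedding hD e (fun t => f (t 0) (t 1))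
  have hN : (Fintype.card (Clause n) : ℝ) ≠ 0 := by
    obtain ⟨C, -⟩ := D.support_nonempty
    have : Nonempty (Clause n) := ⟨C i⟩
    exact_mod_cast Fintype.card_ne_zero
  have hsum : ∑ t : Fin 4 → Clause n, f (t 0) (t 1) =
      (Fintype.card (Clause n) : ℝ) ^ 2 * ∑ c, ∑ c', f c c' := by
    rw [← (Fin.consEquiv fun _ => Clause n).sum_comp, Fintype.sum_prod_type, Finset.mul_sum]
    refine Finset.sum_congr rfl fun c _ => ?_
    rw [← (Fin.consEquiv fun _ => Clause n).sum_comp, Fintype.sum_prod_type, Finset.mul_sum]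
    refine Finset.sum_congr rfl fun c' _ => ?_
    have : ∀ t : Fin 2 → Clause n, f (((Fin.consEquiv fun _ => Clause n)
        (c, (Fin.consEquiv fun _ => Clause n) (c', t))) 0)
        (((Fin.consEquiv fun _ => Clause n) (c, (Fin.consEquiv fun _ => Clause n) (c', t))) 1)
        = f c c' := fun t => rfl
    simp
  rw [hsum] at key
  calc _ = _ := key
    _ = _ := by field_simp

end Independence

/-! ### Coefficient matrices, sign flips and the second moment of Gram entries -/

namespace Clause

variable {n : ℕ}

/-- The sign with which the variable `a` occurs in the clause `c`, and `0` if it does not occur. -/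
noncomputable def sign (c : Clause n) (a : Fin n) : ℝ :=
  (if (a, true) ∈ c.1 then 1 else 0) - (if (a, false) ∈ c.1 then 1 else 0)

/-- The coefficient matrix of a clause: rows are variables `a`, columns are pairs of literals `p`.
The entry is the sign of `a` in `c` if `p` consists of the two other literals of `c`. -/
noncomputable def coeff (c : Clause n) (a : Fin n) (p : Literal n × Literal n) : ℝ :=
  if p.1 ∈ c.1 ∧ p.2 ∈ c.1 ∧ p.1.1 ≠ p.2.1 ∧ p.1.1 ≠ a ∧ p.2.1 ≠ a then c.sign a else 0

/-- The entry at `(a, b)` of the product of the coefficient matrix of `c` and the transpose of that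
of `c'`. -/
noncomputable def gram (c c' : Clause n) (a b : Fin n) : ℝ := ∑ p, c.coeff a p * c'.coeff b p

/-- Negate the literals on the variable `a`. -/
def flipLiteral (a : Fin n) (l : Literal n) : Literal n := if l.1 = a then (l.1, !l.2) else l

@[simp] lemma flipLiteral_fst (a : Fin n) (l : Literal n) : (flipLiteral a l).1 = l.1 := by
  unfold flipLiteral; split_ifs <;> rfl

lemma flipLiteral_involutive (a : Fin n) : Function.Involutive (flipLiteral a) := by
  rintro ⟨b, s⟩
  by_cases h : b = a <;> simp [flipLiteral, h]

lemma mem_image_flipLiteral (a : Fin n) (s : Finset (Literal n)) (l : Literal n) :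
    l ∈ s.image (flipLiteral a) ↔ flipLiteral a l ∈ s := by
  rw [Finset.mem_image]
  constructor
  · rintro ⟨l', h, rfl⟩
    rwa [flipLiteral_involutive]
  · exact fun h => ⟨_, h, flipLiteral_involutive a l⟩

/-- Negate the literal on the variable `a` in a clause. -/
def flip (a : Fin n) (c : Clause n) : Clause n :=
  ⟨c.1.image (flipLiteral a), by
    rw [Finset.card_image_of_injective _ (flipLiteral_involutive a).injective]
    exact c.2.1, by
    intro l hl l' hl' h
    rw [mem_image_flipLiteral] at hl hl'
    exact (flipLiteral_involutive a).injective (c.2.2 _ hl _ hl' (by simpa using h))⟩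

lemma mem_flip {a : Fin n} {c : Clause n} {l : Literal n} :
    l ∈ (flip a c).1 ↔ flipLiteral a l ∈ c.1 := mem_image_flipLiteral a c.1 l

lemma flip_flip (a : Fin n) (c : Clause n) : flip a (flip a c) = c :=
  Subtype.ext <| Finset.ext fun l => by rw [mem_flip, mem_flip, flipLiteral_involutive]

/-- Columns supporting row `a` avoid the variable `a`, so the flip leaves them in place and only
reverses the sign. -/
lemma coeff_flip (a : Fin n) (c : Clause n) (p : Literal n × Literal n) :
    (flip a c).coeff a p = - c.coeff a p := by
  have hs : (flip a c).sign a = - c.sign a := by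
    simp [sign, mem_flip, flipLiteral]
  have hne : ∀ l : Literal n, l.1 ≠ a → flipLiteral a l = l := fun l h => by simp [flipLiteral, h]
  unfold coeff
  by_cases h : p.1.1 ≠ a ∧ p.2.1 ≠ a
  · simp only [mem_flip, hne _ h.1, hne _ h.2, hs]
    split_ifs <;> simp
  · rw [if_neg (by tauto), if_neg (by tauto), neg_zero]

lemma gram_flip_left (a b : Fin n) (c c' : Clause n) :
    (flip a c).gram c' a b = - c.gram c' a b := by
  simp only [gram, coeff_flip, neg_mul, Finset.sum_neg_distrib]

lemma gram_flip_right (a b : Fin n) (c c' : Clause n) :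
    c.gram (flip b c') a b = - c.gram c' a b := by
  simp only [gram, coeff_flip, mul_neg, Finset.sum_neg_distrib]

lemma abs_sign_le_one (c : Clause n) (a : Fin n) : |c.sign a| ≤ 1 := by
  unfold sign; split_ifs <;> norm_num

lemma abs_sign_le (c : Clause n) (a : Fin n) :
    |c.sign a| ≤ ∑ s : Bool, if (a, s) ∈ c.1 then 1 else 0 := by
  rw [Fintype.sum_bool]
  unfold sign; split_ifs <;> norm_num

lemma abs_coeff_le_one (c : Clause n) (a : Fin n) (p : Literal n × Literal n) :
    |c.coeff a p| ≤ 1 := by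
  unfold coeff; split_ifs
  · exact abs_sign_le_one c a
  · simp

lemma abs_coeff_le_ite (c : Clause n) (a : Fin n) (p : Literal n × Literal n) :
    |c.coeff a p| ≤ if p ∈ c.1 ×ˢ c.1 then 1 else 0 := by
  by_cases h : p ∈ c.1 ×ˢ c.1
  · rw [if_pos h]; exact abs_coeff_le_one c a p
  · rw [if_neg h, coeff, if_neg, abs_zero]
    rw [Finset.mem_product] at h
    tauto

lemma abs_gram_le_sum (c c' : Clause n) (a b : Fin n) :
    |c.gram c' a b| ≤ ∑ p, |c.coeff a p| * |c'.coeff b p| := by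
  refine (Finset.abs_sum_le_sum_abs _ _).trans_eq ?_
  simp only [abs_mul]

/-- Crude count: all nine ordered pairs of literals of `c` are allowed. -/
lemma abs_gram_le (c c' : Clause n) (a b : Fin n) : |c.gram c' a b| ≤ 9 := by
  refine (abs_gram_le_sum c c' a b).trans ?_
  calc ∑ p, |c.coeff a p| * |c'.coeff b p|
      ≤ ∑ p, if p ∈ c.1 ×ˢ c.1 then (1 : ℝ) else 0 := Finset.sum_le_sum fun p _ =>
        (mul_le_of_le_one_right (abs_nonneg _) (abs_coeff_le_one c' b p)).trans
          (abs_coeff_le_ite c a p)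
    _ = 9 := by
      rw [Finset.sum_boole, Finset.filter_mem_eq_inter, Finset.univ_inter,
        Finset.card_product, c.2.1]
      norm_num

lemma eq_of_mem {c : Clause n} {x y z : Literal n} (hx : x ∈ c.1) (hy : y ∈ c.1) (hz : z ∈ c.1)
    (hxy : x ≠ y) (hxz : x ≠ z) (hyz : y ≠ z) : c.1 = {x, y, z} := by
  refine (Finset.eq_of_subset_of_card_le ?_ ?_).symm
  · simp [Finset.insert_subset_iff, hx, hy, hz]
  · rw [c.2.1, Finset.card_eq_three.mpr ⟨x, y, z, hxy, hxz, hyz, rfl⟩]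

/-- A clause containing the pair is determined by its third literal, for which there are at most 2n
choices. -/
lemma sum_abs_coeff_le (p : Literal n × Literal n) :
    ∑ c : Clause n, ∑ a, |c.coeff a p| ≤ 2 * n := by
  have h1 : ∀ (c : Clause n) (a : Fin n), |c.coeff a p| ≤ ∑ s : Bool,
      if (a, s) ∈ c.1 ∧ p.1 ∈ c.1 ∧ p.2 ∈ c.1 ∧ p.1.1 ≠ p.2.1 ∧ p.1.1 ≠ a ∧ p.2.1 ≠ a
        then 1 else 0 := by
    intro c a
    unfold coeff
    split_ifs with h
    · simpa [h] using abs_sign_le c a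
    · rw [abs_zero]
      exact Finset.sum_nonneg fun s _ => by split_ifs <;> norm_num
  calc ∑ c : Clause n, ∑ a, |c.coeff a p|
      ≤ ∑ c : Clause n, ∑ a, ∑ s : Bool,
      if (a, s) ∈ c.1 ∧ p.1 ∈ c.1 ∧ p.2 ∈ c.1 ∧ p.1.1 ≠ p.2.1 ∧ p.1.1 ≠ a ∧ p.2.1 ≠ a
        then (1 : ℝ) else 0 :=
        Finset.sum_le_sum fun c _ => Finset.sum_le_sum fun a _ => h1 c a
    _ = ∑ a, ∑ s : Bool, ∑ c : Clause n,
      if (a, s) ∈ c.1 ∧ p.1 ∈ c.1 ∧ p.2 ∈ c.1 ∧ p.1.1 ≠ p.2.1 ∧ p.1.1 ≠ a ∧ p.2.1 ≠ a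
        then (1 : ℝ) else 0 := by
        rw [Finset.sum_comm]
        exact Finset.sum_congr rfl fun a _ => Finset.sum_comm
    _ ≤ ∑ a : Fin n, ∑ s : Bool, (1 : ℝ) := by
        refine Finset.sum_le_sum fun a _ => Finset.sum_le_sum fun s _ => ?_
        rw [Finset.sum_boole]
        norm_cast
        refine Finset.card_le_one.mpr fun c hc c' hc' => Subtype.ext ?_
        simp only [Finset.mem_filter, Finset.mem_univ, true_and] at hc hc'
        obtain ⟨h1, h2, h3, h4, h5, h6⟩ := hc
        have e1 : (a, s) ≠ p.1 := fun h => h5 (by rw [← h])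
        have e2 : (a, s) ≠ p.2 := fun h => h6 (by rw [← h])
        have e3 : p.1 ≠ p.2 := fun h => h4 (by rw [h])
        rw [eq_of_mem h1 h2 h3 e1 e2 e3, eq_of_mem hc'.1 hc'.2.1 hc'.2.2.1 e1 e2 e3]
    _ = 2 * n := by simp [mul_comm]

/-- Using the bound 9 for one factor of the square makes the sum linear in products of coefficients,
which factor for each pair `p`. The 4n² pairs contribute at most 9·(2n)² each. -/
lemma sum_gram_sq_le :
    ∑ c : Clause n, ∑ c' : Clause n, ∑ a, ∑ b, c.gram c' a b ^ 2 ≤ 144 * (n : ℝ) ^ 4 := by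
  have h1 : ∀ (c c' : Clause n) (a b : Fin n),
      c.gram c' a b ^ 2 ≤ 9 * ∑ p, |c.coeff a p| * |c'.coeff b p| := by
    intro c c' a b
    rw [← sq_abs, sq]
    exact mul_le_mul (abs_gram_le c c' a b) (abs_gram_le_sum c c' a b) (abs_nonneg _)
      (by norm_num)
  calc ∑ c : Clause n, ∑ c' : Clause n, ∑ a, ∑ b, c.gram c' a b ^ 2
      ≤ ∑ c : Clause n, ∑ c' : Clause n, ∑ a, ∑ b,
          9 * ∑ p, |c.coeff a p| * |c'.coeff b p| := by
        gcongr with c _ c' _ a _ b _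
        exact h1 c c' a b
    _ = 9 * ∑ p, (∑ c : Clause n, ∑ a, |c.coeff a p|) ^ 2 := by
        rw [Finset.mul_sum]
        have : ∀ p : Literal n × Literal n, 9 * (∑ c : Clause n, ∑ a, |c.coeff a p|) ^ 2 =
            ∑ c : Clause n, ∑ c' : Clause n, ∑ a, ∑ b, 9 * (|c.coeff a p| * |c'.coeff b p|) := by
          intro p
          rw [sq, Finset.sum_mul_sum, Finset.mul_sum]
          refine Finset.sum_congr rfl fun c _ => ?_
          rw [Finset.mul_sum]
          refine Finset.sum_congr rfl fun c' _ => ?_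
          rw [Finset.sum_mul_sum, Finset.mul_sum]
          refine Finset.sum_congr rfl fun a _ => ?_
          rw [Finset.mul_sum]
        simp only [this]
        symm
        refine Finset.sum_comm.trans (Finset.sum_congr rfl fun c _ => ?_)
        refine Finset.sum_comm.trans (Finset.sum_congr rfl fun c' _ => ?_)
        refine Finset.sum_comm.trans (Finset.sum_congr rfl fun a _ => ?_)
        refine Finset.sum_comm.trans (Finset.sum_congr rfl fun b _ => ?_)
        rw [Finset.mul_sum]
    _ ≤ 9 * ∑ p : Literal n × Literal n, (2 * (n : ℝ)) ^ 2 := by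
        gcongr with p _
        exact sum_abs_coeff_le p
    _ = 144 * (n : ℝ) ^ 4 := by
        simp; ring

/-! ### Values under an assignment -/

/-- `1` or `-1` according to whether the literal is true. -/
noncomputable def literalValue (σ : Fin n → Bool) (l : Literal n) : ℝ := if σ l.1 = l.2 then 1 else -1

/-- `1` or `-1` according to the truth value of the variable. -/
noncomputable def varValue (σ : Fin n → Bool) (a : Fin n) : ℝ := if σ a = true then 1 else -1

/-- A weight of pairs of literals that depends on the number of true literals, so that the sum over
the literals of a satisfied clause of the value times the weight of the two others is constant. -/
noncomputable def pairWeight (σ : Fin n → Bool) (p : Literal n × Literal n) : ℝ :=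
  (6 - 3 * (literalValue σ p.1 + literalValue σ p.2)
    + 2 * (literalValue σ p.1 * literalValue σ p.2)) / 2

lemma literalValue_eq (σ : Fin n → Bool) (l : Literal n) :
    literalValue σ l = 1 ∨ literalValue σ l = -1 := by
  unfold literalValue; split_ifs <;> simp

/-- The weight is 1, 2 or 7 when two, one or none of the literals are true. -/
lemma pairWeight_sq_le (σ : Fin n → Bool) (p : Literal n × Literal n) :
    pairWeight σ p ^ 2 ≤ 49 := by
  unfold pairWeight
  rcases literalValue_eq σ p.1 with h | h <;> rcases literalValue_eq σ p.2 with h' | h' <;>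
    rw [h, h'] <;> norm_num

/-- The column sums of the coefficient matrix, weighted by the values of the variables. -/
noncomputable def colSum (σ : Fin n → Bool) (c : Clause n) (p : Literal n × Literal n) : ℝ :=
  ∑ a, c.coeff a p * varValue σ a

lemma colSum_eq (σ : Fin n → Bool) (c : Clause n) (p : Literal n × Literal n) :
    colSum σ c p = if p.1 ∈ c.1 then if p.2 ∈ c.1 then if p.1.1 ≠ p.2.1 then
      ∑ l ∈ c.1, if p.1.1 ≠ l.1 ∧ p.2.1 ≠ l.1 then literalValue σ l else 0
      else 0 else 0 else 0 := by
  split_ifs with h1 h2 h3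
  · rw [← Finset.univ_inter c.1, ← Finset.sum_ite_mem, Fintype.sum_prod_type]
    refine Finset.sum_congr rfl fun a _ => ?_
    rw [Fintype.sum_bool]
    by_cases ha : p.1.1 ≠ a ∧ p.2.1 ≠ a
    · rw [coeff, if_pos ⟨h1, h2, h3, ha⟩]
      simp only [if_pos ha, sign, literalValue, varValue]
      cases σ a <;> by_cases ht : (a, true) ∈ c.1 <;> by_cases hf : (a, false) ∈ c.1 <;>
        simp [ht, hf]
    · rw [coeff, if_neg (by tauto)]
      simp only [if_neg ha]
      simp
  all_goals
    refine Finset.sum_eq_zero fun a _ => ?_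
    rw [coeff, if_neg (by tauto), zero_mul]

lemma sum_ite_mem_product (c : Clause n) (F : Literal n × Literal n → ℝ) :
    ∑ p : Literal n × Literal n, (if p.1 ∈ c.1 then if p.2 ∈ c.1 then F p else 0 else 0) =
      ∑ x ∈ c.1, ∑ y ∈ c.1, F (x, y) := by
  rw [Fintype.sum_prod_type, ← Finset.univ_inter c.1, ← Finset.sum_ite_mem]
  refine Finset.sum_congr rfl fun x _ => ?_
  by_cases hx : x ∈ c.1
  · simp only [Finset.univ_inter, if_pos hx]
    rw [Finset.sum_ite_mem, Finset.univ_inter]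
  · simp [hx]

lemma exists_eq (c : Clause n) : ∃ x y z : Literal n, x.1 ≠ y.1 ∧ x.1 ≠ z.1 ∧ y.1 ≠ z.1 ∧
    c.1 = {x, y, z} := by
  obtain ⟨x, y, z, hxy, hxz, hyz, h⟩ := Finset.card_eq_three.mp c.2.1
  have H := c.2.2
  rw [h] at H
  exact ⟨x, y, z, fun e => hxy (H x (by simp) y (by simp) e),
    fun e => hxz (H x (by simp) z (by simp) e), fun e => hyz (H y (by simp) z (by simp) e), h⟩

/-- Six ordered pairs of distinct literals, each with entry ±1. -/
lemma sum_colSum_sq (σ : Fin n → Bool) (c : Clause n) : ∑ p, colSum σ c p ^ 2 = 6 := by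
  have h0 : ∀ p, colSum σ c p ^ 2 = if p.1 ∈ c.1 then if p.2 ∈ c.1 then
      (if p.1.1 ≠ p.2.1 then
      ∑ l ∈ c.1, if p.1.1 ≠ l.1 ∧ p.2.1 ≠ l.1 then literalValue σ l else 0
      else 0) ^ 2 else 0 else 0 := by
    intro p
    rw [colSum_eq]
    by_cases h1 : p.1 ∈ c.1 <;> by_cases h2 : p.2 ∈ c.1 <;> simp only [h1, h2, if_true, if_false]
      <;> norm_num
  simp only [h0]
  rw [sum_ite_mem_product c fun p => (if p.1.1 ≠ p.2.1 then
      ∑ l ∈ c.1, if p.1.1 ≠ l.1 ∧ p.2.1 ≠ l.1 then literalValue σ l else 0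
      else 0) ^ 2]
  obtain ⟨x, y, z, hxy, hxz, hyz, h⟩ := c.exists_eq
  have exy : x ≠ y := fun e => hxy (by rw [e])
  have exz : x ≠ z := fun e => hxz (by rw [e])
  have eyz : y ≠ z := fun e => hyz (by rw [e])
  rw [h]
  rcases literalValue_eq σ x with h1 | h1 <;> rcases literalValue_eq σ y with h2 | h2 <;>
    rcases literalValue_eq σ z with h3 | h3 <;>
    simp [Finset.sum_insert, exy, exz, eyz, hxy, hxz, hyz, hxy.symm, hxz.symm, hyz.symm,
      h1, h2, h3] <;> norm_num

/-- With three, two or one true literals the sum is 6·1, 8 − 2 or 14 − 8. With none it would be −42.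
-/
lemma sum_pairWeight_mul_colSum (σ : Fin n → Bool) (c : Clause n)
    (hc : ∃ l ∈ c.1, LiteralTrue σ l) : ∑ p, pairWeight σ p * colSum σ c p = 6 := by
  have h0 : ∀ p, pairWeight σ p * colSum σ c p = if p.1 ∈ c.1 then if p.2 ∈ c.1 then
      pairWeight σ p * (if p.1.1 ≠ p.2.1 then
      ∑ l ∈ c.1, if p.1.1 ≠ l.1 ∧ p.2.1 ≠ l.1 then literalValue σ l else 0
      else 0) else 0 else 0 := by
    intro p
    rw [colSum_eq]
    by_cases h1 : p.1 ∈ c.1 <;> by_cases h2 : p.2 ∈ c.1 <;> simp only [h1, h2, if_true, if_false]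
      <;> norm_num
  simp only [h0]
  rw [sum_ite_mem_product c fun p => pairWeight σ p * (if p.1.1 ≠ p.2.1 then
      ∑ l ∈ c.1, if p.1.1 ≠ l.1 ∧ p.2.1 ≠ l.1 then literalValue σ l else 0
      else 0)]
  obtain ⟨x, y, z, hxy, hxz, hyz, h⟩ := c.exists_eq
  have exy : x ≠ y := fun e => hxy (by rw [e])
  have exz : x ≠ z := fun e => hxz (by rw [e])
  have eyz : y ≠ z := fun e => hyz (by rw [e])
  have hT : literalValue σ x = 1 ∨ literalValue σ y = 1 ∨ literalValue σ z = 1 := by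
    obtain ⟨l, hl, ht⟩ := hc
    have hv : literalValue σ l = 1 := if_pos ht
    rw [h] at hl
    simp only [Finset.mem_insert, Finset.mem_singleton] at hl
    rcases hl with rfl | rfl | rfl <;> simp [hv]
  rw [h]
  rcases literalValue_eq σ x with h1 | h1 <;> rcases literalValue_eq σ y with h2 | h2 <;>
    rcases literalValue_eq σ z with h3 | h3 <;>
    first
    | (exfalso; rw [h1, h2, h3] at hT; norm_num at hT; done)
    | (simp [Finset.sum_insert, exy, exz, eyz, hxy, hxz, hyz, hxy.symm, hxz.symm, hyz.symm,
        pairWeight, h1, h2, h3]; norm_num)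

end Clause

/-! ### Expanding the square; counting clauses -/

lemma sq_sum_eq_sum_sq_add {ι : Type*} [Fintype ι] [LinearOrder ι] (z : ι → ℝ) :
    (∑ i, z i) ^ 2 = ∑ i, z i ^ 2 + 2 * ∑ u : ι × ι with u.1 < u.2, z u.1 * z u.2 := by
  have h1 : (∑ i, z i) ^ 2 = ∑ u : ι × ι, z u.1 * z u.2 := by
    rw [sq, Finset.sum_mul_sum, Fintype.sum_prod_type]
  have h2 : ∀ u : ι × ι, z u.1 * z u.2 = (if u.1 = u.2 then z u.1 * z u.2 else 0) +
      ((if u.1 < u.2 then z u.1 * z u.2 else 0) + if u.2 < u.1 then z u.1 * z u.2 else 0) := by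
    intro u
    rcases lt_trichotomy u.1 u.2 with h | h | h
    · simp [h, h.ne, h.not_gt]
    · simp [h]
    · simp [h, h.ne', h.not_gt]
  have h3 : ∑ u : ι × ι, (if u.2 < u.1 then z u.1 * z u.2 else 0) =
      ∑ u : ι × ι, if u.1 < u.2 then z u.1 * z u.2 else 0 := by
    rw [← (Equiv.prodComm ι ι).sum_comp]
    exact Finset.sum_congr rfl fun u _ => by simp [mul_comm]
  have h4 : ∑ u : ι × ι, (if u.1 = u.2 then z u.1 * z u.2 else 0) = ∑ i, z i ^ 2 := by
    rw [Fintype.sum_prod_type]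
    exact Finset.sum_congr rfl fun i _ => by simp [sq]
  rw [h1, Finset.sum_congr rfl fun u _ => h2 u, Finset.sum_add_distrib, Finset.sum_add_distrib,
    h3, h4, Finset.sum_filter, two_mul]

namespace Clause

variable {n : ℕ}

lemma sum_colSum_mul_colSum (σ : Fin n → Bool) (c c' : Clause n) :
    ∑ p, colSum σ c p * colSum σ c' p =
      ∑ a, ∑ b, varValue σ a * varValue σ b * c.gram c' a b := by
  simp only [colSum, gram, Finset.sum_mul_sum]
  rw [Finset.sum_comm]
  refine Finset.sum_congr rfl fun a _ => ?_
  rw [Finset.sum_comm]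
  refine Finset.sum_congr rfl fun b _ => ?_
  rw [Finset.mul_sum]
  exact Finset.sum_congr rfl fun p _ => by ring

lemma varValue_sq (σ : Fin n → Bool) (a : Fin n) : varValue σ a ^ 2 = 1 := by
  unfold varValue; split_ifs <;> norm_num

/-- The clauses without negations already suffice. -/
lemma choose_le_card : n.choose 3 ≤ Fintype.card (Clause n) := by
  let f : {s : Finset (Fin n) // s.card = 3} → Clause n := fun s =>
    ⟨s.1.image fun a => (a, true), by
      rw [Finset.card_image_of_injective _ (Prod.mk_left_injective true)]
      exact s.2, by
      intro l hl l' hl' h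
      simp only [Finset.mem_image] at hl hl'
      obtain ⟨a, -, rfl⟩ := hl
      obtain ⟨b, -, rfl⟩ := hl'
      exact congrArg (fun x => (x, true)) h⟩
  have hf : Function.Injective f := fun s t h =>
    Subtype.ext (Finset.image_injective (Prod.mk_left_injective true) (congrArg Subtype.val h))
  have h := Fintype.card_le_of_injective f hf
  rwa [Fintype.card_finset_len, Fintype.card_fin] at h

lemma cube_le_card (hn : 3 ≤ n) : (n : ℝ) ^ 3 ≤ 27 * Fintype.card (Clause n) := by
  have h1 : (n.choose 3 : ℝ) ≤ Fintype.card (Clause n) := by exact_mod_cast choose_le_card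
  have h2 : 6 * (n.choose 3 : ℝ) = n * (n - 1) * (n - 2) := by
    obtain ⟨k, rfl⟩ := Nat.exists_eq_add_of_le' hn
    have := Nat.add_one_mul_choose_eq (k + 2) 2
    have h' := Nat.add_one_mul_choose_eq (k + 1) 1
    simp only [Nat.choose_one_right, Nat.reduceAdd, add_assoc] at this h'
    have h3 : ((k : ℝ) + 3) * (k + 2).choose 2 = (k + 3).choose 3 * 3 := by exact_mod_cast this
    have h4 : ((k : ℝ) + 2) * (k + 1) = (k + 2).choose 2 * 2 := by exact_mod_cast h'
    push_cast
    linear_combination -2 * h3 - (k + 3 : ℝ) * h4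
  have hn' : (3 : ℝ) ≤ n := by exact_mod_cast hn
  -- 27n(n−1)(n−2) − 6n³ = 3n(n−3)(7n−6).
  nlinarith [mul_nonneg (by linarith : (0 : ℝ) ≤ n)
    (mul_nonneg (sub_nonneg.mpr hn') (by linarith : (0 : ℝ) ≤ 7 * (n : ℝ) - 6))]

lemma three_le (c : Clause n) : 3 ≤ n := by
  have h : Set.InjOn Prod.fst (c.1 : Set (Literal n)) := fun l hl l' hl' e => c.2.2 l hl l' hl' e
  have := Finset.card_le_card (Finset.subset_univ (c.1.image Prod.fst))
  rwa [Finset.card_image_of_injOn h, c.2.1, Finset.card_univ, Fintype.card_fin] at this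

end Clause

open Clause

/-! ### The refutation statistic and its expectation -/

section Refutation

variable {n m : ℕ}

/-- The off-diagonal part of the Gram matrix of the coefficient matrix of an instance. -/
noncomputable def crossGram (C : Instance3SAT n m) (a b : Fin n) : ℝ :=
  ∑ u : Fin m × Fin m with u.1 < u.2, (C u.1).gram (C u.2) a b

lemma sum_sq_sum_colSum (σ : Fin n → Bool) (C : Instance3SAT n m) :
    ∑ p, (∑ i, colSum σ (C i) p) ^ 2 =
      6 * m + 2 * ∑ a, ∑ b, varValue σ a * varValue σ b * crossGram C a b := by
  simp only [sq_sum_eq_sum_sq_add]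
  rw [Finset.sum_add_distrib, Finset.sum_comm]
  simp only [sum_colSum_sq]
  rw [← Finset.mul_sum, Finset.sum_comm]
  simp only [sum_colSum_mul_colSum, crossGram, Finset.mul_sum]
  congr 1
  · simp [mul_comm]
  · rw [Finset.sum_comm]
    refine Finset.sum_congr rfl fun a _ => ?_
    rw [Finset.sum_comm]

/-- The upper bound for the square of the refutation statistic. -/
noncomputable def energy (C : Instance3SAT n m) (t : ℝ) : ℝ :=
  196 * (n : ℝ) ^ 2 * (6 * m + n ^ 2 * t + (∑ a, ∑ b, crossGram C a b ^ 2) / t)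

lemma energy_nonneg (C : Instance3SAT n m) {t : ℝ} (ht : 0 < t) : 0 ≤ energy C t := by
  unfold energy; positivity

lemma sq_le_energy_of_satisfiable {C : Instance3SAT n m} (hC : Satisfiable C) {t : ℝ}
    (ht : 0 < t) : 36 * (m : ℝ) ^ 2 ≤ energy C t := by
  obtain ⟨σ, hσ⟩ := hC
  have h1 : ∑ p, pairWeight σ p * ∑ i, colSum σ (C i) p = 6 * m := by
    simp only [Finset.mul_sum]
    rw [Finset.sum_comm, Finset.sum_congr rfl fun i _ => sum_pairWeight_mul_colSum σ (C i) (hσ i)]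
    simp [mul_comm]
  have h2 : ∑ p, pairWeight σ p ^ 2 ≤ 196 * (n : ℝ) ^ 2 :=
    calc ∑ p, pairWeight σ p ^ 2 ≤ ∑ p : Literal n × Literal n, (49 : ℝ) :=
          Finset.sum_le_sum fun p _ => pairWeight_sq_le σ p
      _ = 196 * (n : ℝ) ^ 2 := by simp; ring
  -- AM-GM; since the variable values square to 1, the bound no longer depends on the assignment.
  have h3 : ∀ a b, 2 * (varValue σ a * varValue σ b * crossGram C a b) ≤
      t + crossGram C a b ^ 2 / t := by
    intro a b
    have hv : (varValue σ a * varValue σ b) ^ 2 = 1 := by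
      rw [mul_pow, varValue_sq, varValue_sq, one_mul]
    rw [← sub_nonneg]
    have : t + crossGram C a b ^ 2 / t - 2 * (varValue σ a * varValue σ b * crossGram C a b) =
        (t * (varValue σ a * varValue σ b) - crossGram C a b) ^ 2 / t := by
      rw [eq_div_iff ht.ne', sub_mul, add_mul, div_mul_cancel₀ _ ht.ne', sub_sq, mul_pow, hv]
      ring
    rw [this]
    positivity
  have h4 : 2 * ∑ a, ∑ b, varValue σ a * varValue σ b * crossGram C a b ≤
      n ^ 2 * t + (∑ a, ∑ b, crossGram C a b ^ 2) / t :=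
    calc 2 * ∑ a, ∑ b, varValue σ a * varValue σ b * crossGram C a b
        = ∑ a, ∑ b, 2 * (varValue σ a * varValue σ b * crossGram C a b) := by
          simp only [Finset.mul_sum]
      _ ≤ ∑ a, ∑ b, (t + crossGram C a b ^ 2 / t) :=
          Finset.sum_le_sum fun a _ => Finset.sum_le_sum fun b _ => h3 a b
      _ = _ := by
          simp only [Finset.sum_add_distrib, Finset.sum_div]
          simp
          ring
  have h5 := Finset.sum_mul_sq_le_sq_mul_sq Finset.univ (pairWeight σ)
    fun p => ∑ i, colSum σ (C i) p
  rw [h1, sum_sq_sum_colSum] at h5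
  have h6 : 0 ≤ ∑ p, (∑ i, colSum σ (C i) p) ^ 2 := Finset.sum_nonneg fun p _ => sq_nonneg _
  rw [sum_sq_sum_colSum] at h6
  calc 36 * (m : ℝ) ^ 2 = (6 * m) ^ 2 := by ring
    _ ≤ _ := h5
    _ ≤ 196 * (n : ℝ) ^ 2 *
        (6 * m + 2 * ∑ a, ∑ b, varValue σ a * varValue σ b * crossGram C a b) :=
        mul_le_mul_of_nonneg_right h2 h6
    _ ≤ energy C t := by
        unfold energy
        refine mul_le_mul_of_nonneg_left ?_ (by positivity)
        linarith

variable {D : PMF (Instance3SAT n m)}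

/-- Two different increasing pairs leave some position of `u` outside `v`: negating `a` in its first
clause or `b` in its second changes the sign of exactly one factor. -/
lemma expect_gram_mul_gram (hD : D ∈ clauseIndependent 4 n m) (hm : 4 ≤ m) (a b : Fin n)
    {u v : Fin m × Fin m} (hu : u.1 < u.2) (hv : v.1 < v.2) (huv : u ≠ v) :
    expect D (fun C => (C u.1).gram (C u.2) a b * (C v.1).gram (C v.2) a b) = 0 := by
  obtain ⟨i, j⟩ := u
  obtain ⟨k, l⟩ := v
  simp only at hu hv ⊢
  have hS : ({i, j, k, l} : Finset (Fin m)).card ≤ 4 := Finset.card_le_four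
  have hf : ∀ C C' : Instance3SAT n m, (∀ x ∈ ({i, j, k, l} : Finset (Fin m)), C x = C' x) →
      (C i).gram (C j) a b * (C k).gram (C l) a b =
        (C' i).gram (C' j) a b * (C' k).gram (C' l) a b := by
    intro C C' h
    rw [h i (by simp), h j (by simp), h k (by simp), h l (by simp)]
  by_cases hi : i = k ∨ i = l
  · have hjk : k ≠ j := by
      rintro rfl
      rcases hi with rfl | rfl
      · exact lt_irrefl _ hu
      · exact lt_asymm hu hv
    have hjl : l ≠ j := by
      rintro rfl
      rcases hi with rfl | rfl
      · exact huv rfl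
      · exact lt_irrefl _ hu
    refine expect_eq_zero_of_odd hD hm _ hS _ hf j (by simp) (flip b) (flip_flip b) fun C => ?_
    rw [Function.update_self, Function.update_of_ne hu.ne, Function.update_of_ne hjk,
      Function.update_of_ne hjl, gram_flip_right, neg_mul]
  · rw [not_or] at hi
    refine expect_eq_zero_of_odd hD hm _ hS _ hf i (by simp) (flip a) (flip_flip a) fun C => ?_
    rw [Function.update_self, Function.update_of_ne hu.ne', Function.update_of_ne (Ne.symm hi.1),
      Function.update_of_ne (Ne.symm hi.2), gram_flip_left, neg_mul]

lemma expect_crossGram_sq (hD : D ∈ clauseIndependent 4 n m) (hm : 4 ≤ m) (a b : Fin n) :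
    expect D (fun C => crossGram C a b ^ 2) = ∑ u : Fin m × Fin m with u.1 < u.2,
      (1 / (Fintype.card (Clause n) : ℝ)) ^ 2 * ∑ c : Clause n, ∑ c', c.gram c' a b ^ 2 := by
  simp only [crossGram, sq (Finset.sum _ _), Finset.sum_mul_sum]
  rw [expect.finset_sum]
  refine Finset.sum_congr rfl fun u hu => ?_
  have hu' : u.1 < u.2 := (Finset.mem_filter.mp hu).2
  rw [expect.finset_sum, Finset.sum_eq_single_of_mem u hu]
  · rw [← expect_pair hD hm hu'.ne fun c c' => c.gram c' a b ^ 2]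
    simp only [sq]
  · intro v hv hvu
    exact expect_gram_mul_gram hD hm a b hu' (Finset.mem_filter.mp hv).2 hvu.symm

/-- At most m² pairs of positions, probability at most (27/n³)² for each pair of clauses, and 144n⁴
from `sum_gram_sq_le`; 324 = 27·12. -/
lemma expect_sum_crossGram_sq_le (hD : D ∈ clauseIndependent 4 n m) (hm : 4 ≤ m) (hn : 3 ≤ n) :
    expect D (fun C => ∑ a, ∑ b, crossGram C a b ^ 2) ≤ (324 * m / n) ^ 2 := by
  have hN := cube_le_card hn
  have hn0 : (0 : ℝ) < n := by exact_mod_cast (by omega : 0 < n)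
  have hN0 : (0 : ℝ) < Fintype.card (Clause n) := by
    have : (0 : ℝ) < (n : ℝ) ^ 3 := by positivity
    linarith
  have hinv : 1 / (Fintype.card (Clause n) : ℝ) ≤ 27 / (n : ℝ) ^ 3 := by
    rw [div_le_div_iff₀ hN0 (by positivity)]
    linarith
  have hcard : ((Finset.univ.filter fun u : Fin m × Fin m => u.1 < u.2).card : ℝ) ≤
      (m : ℝ) ^ 2 := by
    have h := Finset.card_filter_le (Finset.univ : Finset (Fin m × Fin m)) fun u => u.1 < u.2
    rw [Finset.card_univ, Fintype.card_prod, Fintype.card_fin] at h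
    rw [sq]
    exact_mod_cast h
  have hgram : ∑ a, ∑ b, ∑ c : Clause n, ∑ c', c.gram c' a b ^ 2 ≤ 144 * (n : ℝ) ^ 4 := by
    refine le_of_eq_of_le ?_ (sum_gram_sq_le (n := n))
    symm
    calc ∑ c : Clause n, ∑ c' : Clause n, ∑ a, ∑ b, c.gram c' a b ^ 2
        = ∑ c : Clause n, ∑ a, ∑ b, ∑ c' : Clause n, c.gram c' a b ^ 2 := by
          refine Finset.sum_congr rfl fun c _ => Finset.sum_comm.trans ?_
          exact Finset.sum_congr rfl fun a _ => Finset.sum_comm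
      _ = _ := by
          refine Finset.sum_comm.trans ?_
          exact Finset.sum_congr rfl fun a _ => Finset.sum_comm
  have hgram0 : 0 ≤ ∑ a, ∑ b, ∑ c : Clause n, ∑ c', c.gram c' a b ^ 2 := by positivity
  simp only [expect.finset_sum, expect_crossGram_sq hD hm, Finset.sum_const, nsmul_eq_mul,
    ← Finset.mul_sum]
  calc _ ≤ (m : ℝ) ^ 2 * ((27 / (n : ℝ) ^ 3) ^ 2 * (144 * (n : ℝ) ^ 4)) :=
        mul_le_mul hcard (mul_le_mul (pow_le_pow_left₀ (by positivity) hinv 2) hgram hgram0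
          (by positivity)) (mul_nonneg (by positivity) hgram0) (by positivity)
    _ = (324 * m / n) ^ 2 := by field_simp; norm_num

lemma prob_satisfiable_le (hm : 1 ≤ m) (hD : D ∈ clauseIndependent 4 n m) :
    prob D {C | Satisfiable C} ≤ 4288 * (n : ℝ) ^ 2 / m := by
  obtain ⟨C₀, -⟩ := D.support_nonempty
  have hn : 3 ≤ n := (C₀ ⟨0, hm⟩).three_le
  have hn' : (3 : ℝ) ≤ n := by exact_mod_cast hn
  have hm' : (0 : ℝ) < m := by exact_mod_cast hm
  -- For m < 4 independence says nothing, but the bound exceeds 1.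
  rcases lt_or_ge m 4 with hm4 | hm4
  · refine (prob_le_one D _).trans ?_
    have : (m : ℝ) ≤ 4 := by exact_mod_cast hm4.le
    rw [le_div_iff₀ hm']
    nlinarith
  have hn0 : (0 : ℝ) < n := by linarith
  -- This `t` balances the two AM-GM terms: n²t and the bound for the expected quotient both equal
  -- 324m.
  set t : ℝ := 324 * m / n ^ 2 with ht
  have ht0 : 0 < t := by positivity
  have h1 := mul_prob_le_expect D {C | Satisfiable C} (fun C => energy C t) (36 * (m : ℝ) ^ 2)
    (fun C => energy_nonneg C ht0) fun C hC => sq_le_energy_of_satisfiable hC ht0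
  have h2 : expect D (fun C => energy C t) = 196 * (n : ℝ) ^ 2 * (6 * m + n ^ 2 * t +
      expect D (fun C => ∑ a, ∑ b, crossGram C a b ^ 2) / t) := by
    simp only [energy, div_eq_inv_mul]
    rw [expect.const_mul, expect.add, expect.const, expect.const_mul]
  have h3 : expect D (fun C => ∑ a, ∑ b, crossGram C a b ^ 2) / t ≤ 324 * m := by
    rw [div_le_iff₀ ht0]
    refine (expect_sum_crossGram_sq_le hD hm4 hn).trans_eq ?_
    rw [ht]
    field_simp
  have h4 : (n : ℝ) ^ 2 * t = 324 * m := by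
    rw [ht]
    field_simp
  -- 654 = 6 + 324 + 324; in the end 196·654/36 < 3561, below 4288.
  have h5 : 36 * (m : ℝ) ^ 2 * prob D {C | Satisfiable C} ≤ 196 * (n : ℝ) ^ 2 * (654 * m) := by
    refine h1.trans ?_
    rw [h2]
    refine mul_le_mul_of_nonneg_left ?_ (by positivity)
    linarith
  have h6 : (m : ℝ) * (36 * (m * prob D {C | Satisfiable C})) ≤ m * (196 * 654 * (n : ℝ) ^ 2) := by
    linarith
  have h7 := le_of_mul_le_mul_left h6 hm'
  rw [le_div_iff₀ hm']
  have : (0 : ℝ) ≤ (n : ℝ) ^ 2 := sq_nonneg _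
  linarith

/-- 12864 = 3·4288 brings the bound down to 1/3. -/
lemma mem_unsatSizes (hn : 3 ≤ n) : 12864 * n ^ 2 ∈ unsatSizes 4 n := by
  intro D hD
  have hn0 : 0 < n := by omega
  have hm : 1 ≤ 12864 * n ^ 2 := Nat.succ_le_of_lt (by positivity)
  refine (prob_satisfiable_le hm hD).trans ?_
  have : (0 : ℝ) < n := by exact_mod_cast hn0
  push_cast
  rw [div_le_iff₀ (by positivity)]
  linarith

end Refutation

theorem theorem3 :
    (∃ K : ℝ, ∀ n : ℕ, 3 ≤ n →
      IsLeast (unsatSizes 4 n) (UST 4 n) ∧ (UST 4 n : ℝ) ≤ K * (n : ℝ) ^ 2) ∧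
    (∃ K : ℝ, ∀ n m : ℕ, 1 ≤ n → 1 ≤ m → ∀ D ∈ clauseIndependent 4 n m,
      prob D {C | Satisfiable C} ≤ K * max ((n : ℝ) ^ 2 / (m : ℝ)) (1 / Real.sqrt (n : ℝ))) ∧
    (∀ n m : ℕ, 1 ≤ n → 1 ≤ m → (m : ℝ) ≤ Real.sqrt 10 * (n : ℝ) ^ ((5 : ℝ) / 2) →
      ∀ D ∈ clauseIndependent 4 n m,
        prob D {C | Satisfiable C} ≤ 4288 * (n : ℝ) ^ 2 / (m : ℝ)) := by
  refine ⟨⟨12864, fun n hn => ⟨⟨Nat.sInf_mem ⟨_, mem_unsatSizes hn⟩, fun m hm => Nat.sInf_le hm⟩,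
    ?_⟩⟩, ⟨4288, fun n m _ hm D hD => ?_⟩, fun n m _ hm _ D hD => prob_satisfiable_le hm hD⟩
  · exact_mod_cast Nat.sInf_le (mem_unsatSizes hn)
  · refine (prob_satisfiable_le hm hD).trans ?_
    rw [mul_div_assoc]
    exact mul_le_mul_of_nonneg_left (le_max_left _ _) (by norm_num)
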